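/- Let $\Gamma$ be a (not necessarily commutative) cancellation monoid, i.e. a monoid in which both the left and the right cancellation laws hold, and let $R=\bigoplus_{\alpha\in\Gamma}R_\alpha$ be a $\Gamma$-graded (associative, unital, not necessarily commutative) ring. A submodule of a $\Gamma$-graded left $R$-module $M=\bigoplus_{\alpha\in\Gamma} M_\alpha$ is called graded if it is generated by homogeneous elements; a homogeneous left ideal of $R$ is a graded submodule of the left $R$-module $R$. The ring $R$ is called graded left semihereditary if every finitely generated homogeneous left ideal of $R$ is a projective $R$-module, and graded left coherent if every finitely generated homogeneous left ideal of $R$ is finitely presented. A left $R$-module $F$ (graded by $\Gamma$) is called gr-flat if $f\otimes_R 1_F\colon M\otimes_R F\to N\otimes_R F$ is injective for every injective homomorphism $f\colon M\to N$ of $\Gamma$-graded right $R$-modules with $f(M_\alpha)\subseteq N_\alpha$ for all $\alpha\in\Gamma$. Then $R$ is graded left semihereditary if and only if $R$ is graded left coherent and every graded submodule of a gr-flat $\Gamma$-graded left $R$-module is gr-flat. The same equivalence holds with "gr-flat" replaced by "flat" (in the ordinary sense) in both places: $R$ is graded left semihereditary if and only if $R$ is graded left coherent and every graded submodule of a flat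 $\Gamma$-graded left $R$-module is flat. -/

import Mathlib

open scoped TensorProduct

universe u v w

section BalancedTensor

variable (R : Type*) [Ring R]

/-- The subgroup of `M ⊗[ℤ] F` generated by the elements `(m r) ⊗ x - m ⊗ (r x)`, for a right
`R`-module `M` (a module over `Rᵐᵒᵖ`) and a left `R`-module `F`. -/
def balancingRelations (M F : Type*) [AddCommGroup M] [Module Rᵐᵒᵖ M]
    [AddCommGroup F] [Module R F] : AddSubgroup (M ⊗[ℤ] F) :=
  AddSubgroup.closure {t | ∃ (m : M) (r : R) (x : F),
    t = (MulOpposite.op r • m) ⊗ₜ[ℤ] x - m ⊗ₜ[ℤ] (r • x)}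

/-- The tensor product `M ⊗_R F` of a right `R`-module `M` and a left `R`-module `F` over a not
necessarily commutative ring `R`; it is an abelian group. -/
abbrev BalancedTensor (M F : Type*) [AddCommGroup M] [Module Rᵐᵒᵖ M]
    [AddCommGroup F] [Module R F] : Type _ :=
  (M ⊗[ℤ] F) ⧸ balancingRelations R M F

variable {R} {M N : Type*} [AddCommGroup M] [Module Rᵐᵒᵖ M] [AddCommGroup N] [Module Rᵐᵒᵖ N]

/-- The map `M ⊗[ℤ] F → N ⊗[ℤ] F`, `m ⊗ x ↦ f m ⊗ x`, induced by a homomorphism `f : M → N` of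
right `R`-modules. -/
noncomputable def intTensorMap (F : Type*) [AddCommGroup F] (f : M →ₗ[Rᵐᵒᵖ] N) :
    M ⊗[ℤ] F →+ N ⊗[ℤ] F :=
  (f.toAddMonoidHom.toIntLinearMap.rTensor F).toAddMonoidHom

@[simp]
theorem intTensorMap_tmul (F : Type*) [AddCommGroup F] (f : M →ₗ[Rᵐᵒᵖ] N) (m : M) (x : F) :
    intTensorMap F f (m ⊗ₜ[ℤ] x) = f m ⊗ₜ[ℤ] x := rfl

theorem balancingRelations_le_comap (F : Type*) [AddCommGroup F] [Module R F]
    (f : M →ₗ[Rᵐᵒᵖ] N) :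
    balancingRelations R M F ≤ (balancingRelations R N F).comap (intTensorMap F f) := by
  refine (AddSubgroup.closure_le _).2 ?_
  rintro _ ⟨m, r, x, rfl⟩
  exact AddSubgroup.subset_closure ⟨f m, r, x, by simp⟩

/-- The map `f ⊗ 1 : M ⊗_R F → N ⊗_R F`, `m ⊗ x ↦ f m ⊗ x`, induced by a homomorphism
`f : M → N` of right `R`-modules. -/
noncomputable def balancedMap (F : Type*) [AddCommGroup F] [Module R F] (f : M →ₗ[Rᵐᵒᵖ] N) :
    BalancedTensor R M F →+ BalancedTensor R N F :=
  QuotientAddGroup.map _ _ (intTensorMap F f) (balancingRelations_le_comap F f)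

end BalancedTensor

/-- A left `R`-module `F` is flat if `- ⊗_R F` preserves injectivity of homomorphisms of right
`R`-modules (Mathlib's `Module.Flat` is restricted to commutative rings). The test modules range over a universe that contains all
right ideals of `R`, so the notion does not depend on it. -/
def IsFlatLeftModule (R : Type u) [Ring R] (F : Type w) [AddCommGroup F] [Module R F] : Prop :=
  ∀ (M N : Type (max u w)) [AddCommGroup M] [Module Rᵐᵒᵖ M] [AddCommGroup N] [Module Rᵐᵒᵖ N]
    (f : M →ₗ[Rᵐᵒᵖ] N), Function.Injective f → Function.Injective (balancedMap (R := R) F f)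

section Graded

variable {Γ : Type v} [AddMonoid Γ] [DecidableEq Γ] {R : Type u} [Ring R]

/-- `ℳ` is a grading of the right `R`-module `M`: `M` is the internal direct sum of the `ℳ γ`,
and `ℳ β · 𝒜 α ⊆ ℳ (β + α)`. -/
structure IsGradedRightModule (𝒜 : Γ → AddSubgroup R) {M : Type*} [AddCommGroup M]
    [Module Rᵐᵒᵖ M] (ℳ : Γ → AddSubgroup M) : Prop where
  isInternal : DirectSum.IsInternal ℳ
  smul_mem : ∀ ⦃α β : Γ⦄ ⦃r : R⦄ ⦃m : M⦄, r ∈ 𝒜 α → m ∈ ℳ β →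
    MulOpposite.op r • m ∈ ℳ (β + α)

/-- A submodule of a graded left module is graded if it is generated by homogeneous elements.
For a left ideal of a graded ring this says that the ideal is homogeneous. -/
def IsGradedSubmodule {M : Type*} [AddCommGroup M] [Module R M] (ℳ : Γ → AddSubgroup M)
    (N : Submodule R M) : Prop :=
  ∃ S : Set M, (∀ x ∈ S, SetLike.IsHomogeneousElem ℳ x) ∧ N = Submodule.span R S

/-- A graded left `R`-module `F` is gr-flat if `f ⊗ 1 : M ⊗_R F → N ⊗_R F` is injective for every
injective degree-preserving homomorphism `f : M → N` of graded right `R`-modules.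
(The grading of `F` itself plays no role in this condition.) -/
def IsGradedFlat (𝒜 : Γ → AddSubgroup R) (F : Type w) [AddCommGroup F] [Module R F] : Prop :=
  ∀ (M N : Type (max u w)) [AddCommGroup M] [Module Rᵐᵒᵖ M] [AddCommGroup N] [Module Rᵐᵒᵖ N]
    (ℳ : Γ → AddSubgroup M) (𝒩 : Γ → AddSubgroup N),
    IsGradedRightModule 𝒜 ℳ → IsGradedRightModule 𝒜 𝒩 →
    ∀ f : M →ₗ[Rᵐᵒᵖ] N, (∀ γ, ∀ x ∈ ℳ γ, f x ∈ 𝒩 γ) →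
      Function.Injective f → Function.Injective (balancedMap (R := R) F f)

/-- Every finitely generated homogeneous left ideal is projective as a left `R`-module. -/
def IsGradedLeftSemihereditary (𝒜 : Γ → AddSubgroup R) : Prop :=
  ∀ I : Ideal R, I.FG → IsGradedSubmodule 𝒜 I → Module.Projective R I

/-- Every finitely generated homogeneous left ideal is finitely presented. -/
def IsGradedLeftCoherent (𝒜 : Γ → AddSubgroup R) : Prop :=
  ∀ I : Ideal R, I.FG → IsGradedSubmodule 𝒜 I → Module.FinitePresentation R I

end Graded

/-! Everything goes through the equational criterion: a map `Rⁿ → F` killing finitely many vectors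
factors through a finite free module in which they already die. The criterion implies flatness
(`EquationalCriterion.balancedMap_injective`). Conversely, gr-flatness tested on right ideals with
homogeneous generators gives it for one homogeneous relation, and on a graded module this case
implies the full criterion by splitting into components. So gr-flat and flat agree for graded
modules, and both equivalences have one proof.

If `R` is graded semihereditary, a degree-preserving `ψ : Rⁿ → Rᵐ` has an endomorphism `π` of `Rⁿ`
that kills `ker ψ` and satisfies `ψπ = ψ` (`exists_retraction`). When `φ : Rⁿ → N ⊆ M` becomes `χψ`
in `M`, then `φπ = φ`, so the criterion descends to `N`. Conversely, homogeneous left ideals lie in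
the flat module `R`; coherence makes the finitely generated ones finitely presented, and the
criterion then makes them projective. -/

/-! ### The equational criterion and projectivity -/

section EquationalCriterion

variable {R : Type*} [Ring R]

/-- The homomorphism `φ : Rⁿ → F` factors through a finite free module in such a way that
the elements of `T` are killed by the first factor. -/
def FactorsThroughFree {F : Type*} [AddCommGroup F] [Module R F] {n : ℕ}
    (φ : (Fin n → R) →ₗ[R] F) (T : Set (Fin n → R)) : Prop :=
  ∃ (m : ℕ) (ψ : (Fin n → R) →ₗ[R] (Fin m → R)) (χ : (Fin m → R) →ₗ[R] F),
    χ ∘ₗ ψ = φ ∧ ∀ t ∈ T, ψ t = 0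

variable (R) in
/-- The equational criterion for flatness of a left module. -/
def EquationalCriterion (F : Type*) [AddCommGroup F] [Module R F] : Prop :=
  ∀ (n : ℕ) (φ : (Fin n → R) →ₗ[R] F) (T : Finset (Fin n → R)),
    (∀ t ∈ T, φ t = 0) → FactorsThroughFree φ (T : Set (Fin n → R))

/-- A finitely presented module that satisfies the equational criterion is projective. -/
theorem EquationalCriterion.projective {F : Type*} [AddCommGroup F] [Module R F]
    (h : EquationalCriterion R F) [Module.FinitePresentation R F] : Module.Projective R F := by
  obtain ⟨n, φ, hφ⟩ := Module.Finite.exists_fin' R F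
  obtain ⟨T, hT⟩ := Module.FinitePresentation.fg_ker φ hφ
  have hT0 : ∀ t ∈ T, φ t = 0 := fun t ht => by
    have : t ∈ LinearMap.ker φ := hT ▸ Submodule.subset_span ht
    exact this
  obtain ⟨m, ψ, χ, hχ, hψ⟩ := h n φ T hT0
  have hker : LinearMap.ker φ ≤ LinearMap.ker ψ := by
    rw [← hT, Submodule.span_le]
    exact hψ
  -- `ψ` kills generators of `ker φ`, so it descends to `F ≅ Rⁿ / ker φ`; `χ` then exhibits `F` as a
  -- retract of `Rᵐ`.
  refine Module.Projective.of_split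
    (((LinearMap.ker φ).liftQ ψ hker) ∘ₗ (φ.quotKerEquivOfSurjective hφ).symm.toLinearMap) χ ?_
  ext x
  obtain ⟨y, rfl⟩ := hφ x
  have : (φ.quotKerEquivOfSurjective hφ).symm (φ y) = Submodule.Quotient.mk y := by
    rw [LinearEquiv.symm_apply_eq]
    rfl
  simp only [LinearMap.comp_apply, LinearEquiv.coe_coe, this, LinearMap.id_apply]
  rw [Submodule.liftQ_apply, ← hχ, LinearMap.comp_apply]

/-- The base ring satisfies the equational criterion. -/
theorem equationalCriterion_self : EquationalCriterion R R := by
  intro n φ T hT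
  refine ⟨1, LinearMap.pi fun _ => φ, LinearMap.proj 0, ?_, fun t ht => ?_⟩
  · ext; simp
  · ext; simp [hT t ht]

theorem EquationalCriterion.of_equiv {F G : Type*} [AddCommGroup F] [Module R F]
    [AddCommGroup G] [Module R G] (h : EquationalCriterion R F) (e : F ≃ₗ[R] G) :
    EquationalCriterion R G := by
  intro n φ T hT
  obtain ⟨m, ψ, χ, hχ, hψ⟩ := h n (e.symm.toLinearMap ∘ₗ φ) T (fun t ht => by simp [hT t ht])
  refine ⟨m, ψ, e.toLinearMap ∘ₗ χ, ?_, hψ⟩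
  rw [LinearMap.comp_assoc, hχ, ← LinearMap.comp_assoc]
  simp

end EquationalCriterion

/-! ### Vanishing of tensors, and flatness from the equational criterion -/

section Vanishing

variable {R : Type*} [Ring R] {M N F : Type*} [AddCommGroup M] [Module Rᵐᵒᵖ M]
  [AddCommGroup N] [Module Rᵐᵒᵖ N] [AddCommGroup F] [Module R F] {ι : Type*}

/-- The linear combination `∑ vᵢ aᵢ` of elements of a right module. -/
noncomputable def rightCombination (v : ι → M) : (ι →₀ R) →+ M :=
  Finsupp.liftAddHom fun i =>
    AddMonoidHom.mk' (fun r : R => MulOpposite.op r • v i) fun r s => by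
      rw [MulOpposite.op_add, add_smul]

@[simp]
theorem rightCombination_single (v : ι → M) (i : ι) (r : R) :
    rightCombination v (Finsupp.single i r) = MulOpposite.op r • v i := by
  simp [rightCombination]

theorem rightCombination_apply (v : ι → M) (a : ι →₀ R) :
    rightCombination v a = a.sum fun i r => MulOpposite.op r • v i := rfl

theorem rightCombination_mul (v : ι → M) (a : ι →₀ R) (r : R) :
    rightCombination v (a.mapRange (· * r) (zero_mul r)) =
      MulOpposite.op r • rightCombination v a := by
  induction a using Finsupp.induction_linear with
  | zero => simp
  | add a b ha hb =>
    rw [Finsupp.mapRange_add (fun _ _ => add_mul _ _ _), map_add, map_add, ha, hb, smul_add]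
  | single i s =>
    rw [Finsupp.mapRange_single, rightCombination_single, rightCombination_single,
      MulOpposite.op_mul, mul_smul]

variable (R F) in
/-- The family `(aᵢ y)`, as a biadditive function of the family `a` and of `y`. -/
noncomputable def familySMul (ι : Type*) : (ι →₀ R) →+ F →+ (ι →₀ F) :=
  AddMonoidHom.mk' (fun a => AddMonoidHom.mk'
    (fun y => a.mapRange (· • y) (zero_smul R y)) fun y z => by ext; simp)
    fun a b => by ext; simp [add_smul]

@[simp]
theorem familySMul_apply (a : ι →₀ R) (y : F) (i : ι) : familySMul R F ι a y i = a i • y := rfl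

theorem familySMul_single (i : ι) (r : R) (y : F) :
    familySMul R F ι (Finsupp.single i r) y = Finsupp.single i (r • y) := by
  classical
  ext j
  by_cases h : i = j <;> simp [h]

/-- The group of families `x` for which `∑ vᵢ ⊗ xᵢ` vanishes trivially: it is generated by
the families `(aᵢ y)` with `∑ vᵢ aᵢ = 0`. -/
noncomputable def trivialRelations (R : Type*) [Ring R] {M : Type*} [AddCommGroup M] [Module Rᵐᵒᵖ M]
    (F : Type*) [AddCommGroup F] [Module R F] {ι : Type*} (v : ι → M) : AddSubgroup (ι →₀ F) :=
  AddSubgroup.closure {g | ∃ (a : ι →₀ R) (y : F),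
    rightCombination v a = 0 ∧ g = familySMul R F ι a y}

theorem exists_of_mem_trivialRelations {v : ι → M} {g : ι →₀ F}
    (hg : g ∈ trivialRelations R F v) :
    ∃ (k : ℕ) (a : Fin k → ι →₀ R) (y : Fin k → F), (∀ j, rightCombination v (a j) = 0) ∧
      g = ∑ j, familySMul R F ι (a j) (y j) := by
  induction hg using AddSubgroup.closure_induction with
  | mem g hg =>
    obtain ⟨a, y, ha, rfl⟩ := hg
    exact ⟨1, fun _ => a, fun _ => y, fun _ => ha, by simp⟩
  | zero => exact ⟨0, Fin.elim0, Fin.elim0, fun j => j.elim0, by simp⟩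
  | add g h _ _ ihg ihh =>
    obtain ⟨k, a, y, ha, rfl⟩ := ihg
    obtain ⟨l, b, z, hb, rfl⟩ := ihh
    refine ⟨k + l, Fin.append a b, Fin.append y z, fun j => ?_, ?_⟩
    · refine Fin.addCases (fun j => ?_) (fun j => ?_) j
      · simpa using ha j
      · simpa using hb j
    · simp [Fin.sum_univ_add]
  | neg g _ ih =>
    obtain ⟨k, a, y, ha, rfl⟩ := ih
    exact ⟨k, fun j => -a j, y, fun j => by simp [ha j], by simp⟩

theorem familySMul_sub_mem {v : ι → M} {a b : ι →₀ R}
    (h : rightCombination v a = rightCombination v b) (y : F) :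
    (familySMul R F ι a y : (ι →₀ F) ⧸ trivialRelations R F v) = familySMul R F ι b y := by
  rw [QuotientAddGroup.eq]
  refine AddSubgroup.subset_closure ⟨-a + b, y, by simp [h], by simp⟩

/-- The map `x ↦ ∑ vᵢ ⊗ xᵢ`. -/
noncomputable def tensorCombination (R : Type*) [Ring R] {M : Type*} [AddCommGroup M]
    [Module Rᵐᵒᵖ M] (F : Type*) [AddCommGroup F] [Module R F] {ι : Type*} (v : ι → M) :
    (ι →₀ F) →+ BalancedTensor R M F :=
  Finsupp.liftAddHom fun i => (QuotientAddGroup.mk' (balancingRelations R M F)).comp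
    (TensorProduct.mk ℤ M F (v i)).toAddMonoidHom

@[simp]
theorem tensorCombination_single (v : ι → M) (i : ι) (x : F) :
    tensorCombination R F v (Finsupp.single i x) = ((v i ⊗ₜ[ℤ] x : M ⊗[ℤ] F) :
      BalancedTensor R M F) := by
  simp [tensorCombination]

theorem mk_smul_tmul (m : M) (r : R) (x : F) :
    (((MulOpposite.op r • m) ⊗ₜ[ℤ] x : M ⊗[ℤ] F) : BalancedTensor R M F) =
      ((m ⊗ₜ[ℤ] (r • x) : M ⊗[ℤ] F) : BalancedTensor R M F) := by
  rw [← sub_eq_zero, ← QuotientAddGroup.mk_sub, QuotientAddGroup.eq_zero_iff]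
  exact AddSubgroup.subset_closure ⟨m, r, x, rfl⟩

/-- If the family `v` generates `M` and `∑ vᵢ ⊗ xᵢ = 0`, then this sum vanishes trivially. -/
theorem mem_trivialRelations {v : ι → M} (hv : Function.Surjective (rightCombination (R := R) v))
    {x : ι →₀ F} (hx : tensorCombination R F v x = 0) : x ∈ trivialRelations R F v := by
  choose c hc using hv
  -- The choice `c` of coefficients need not be additive, but two families with the same combination
  -- differ by a trivial relation. Modulo these, `m ⊗ y ↦ (c(m)ᵢ y)` is biadditive and balanced, and
  -- it gives a left inverse of `tensorCombination` there.
  let B : M →+ F →+ (ι →₀ F) ⧸ trivialRelations R F v :=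
    AddMonoidHom.mk' (fun m => (QuotientAddGroup.mk' _).comp (familySMul R F ι (c m)))
      fun m m' => by
        ext y
        have := familySMul_sub_mem (a := c (m + m')) (b := c m + c m') (v := v)
          (by simp [hc]) y
        simpa using this
  let Φ : M ⊗[ℤ] F →+ (ι →₀ F) ⧸ trivialRelations R F v :=
    TensorProduct.liftAddHom B fun k m y => by simp
  have hΦ : ∀ m y, Φ (m ⊗ₜ y) = (familySMul R F ι (c m) y : (ι →₀ F) ⧸ trivialRelations R F v) :=
    fun m y => rfl
  have hker : balancingRelations R M F ≤ Φ.ker := by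
    refine (AddSubgroup.closure_le _).2 ?_
    rintro _ ⟨m, r, y, rfl⟩
    have key : familySMul R F ι (c m) (r • y) =
        familySMul R F ι ((c m).mapRange (· * r) (zero_mul r)) y := by
      ext i
      simp [mul_smul]
    rw [SetLike.mem_coe, AddMonoidHom.mem_ker, map_sub, hΦ, hΦ, sub_eq_zero, key]
    exact familySMul_sub_mem (by rw [rightCombination_mul, hc, hc]) y
  let Ψ := QuotientAddGroup.lift _ Φ hker
  have hΨ : Ψ.comp (tensorCombination R F v) = QuotientAddGroup.mk' _ := by
    ext i y
    simp only [AddMonoidHom.comp_apply, Finsupp.singleAddHom_apply, tensorCombination_single]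
    refine (familySMul_sub_mem (b := Finsupp.single i 1) (by simp [hc]) y).trans ?_
    rw [familySMul_single, one_smul]
    rfl
  have := DFunLike.congr_fun hΨ x
  rw [AddMonoidHom.comp_apply, hx, map_zero] at this
  exact (QuotientAddGroup.eq_zero_iff _).1 this.symm

theorem tensorCombination_id_surjective :
    Function.Surjective (tensorCombination R F (id : M → M)) := by
  intro z
  induction z using QuotientAddGroup.induction_on with
  | H t =>
    induction t using TensorProduct.induction_on with
    | zero => exact ⟨0, by simp⟩
    | tmul m x => exact ⟨Finsupp.single m x, by simp⟩
    | add s t hs ht =>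
      obtain ⟨a, ha⟩ := hs
      obtain ⟨b, hb⟩ := ht
      exact ⟨a + b, by rw [map_add, ha, hb, QuotientAddGroup.mk_add]⟩

theorem balancedMap_tensorCombination (f : M →ₗ[Rᵐᵒᵖ] N) (v : ι → M) (x : ι →₀ F) :
    balancedMap (R := R) F f (tensorCombination R F v x) = tensorCombination R F (f ∘ v) x := by
  have : (balancedMap (R := R) F f).comp (tensorCombination R F v) =
      tensorCombination R F (f ∘ v) := by
    ext i y
    simp only [AddMonoidHom.comp_apply, Finsupp.singleAddHom_apply, tensorCombination_single]
    rfl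
  exact DFunLike.congr_fun this x

theorem tensorCombination_comp_embDomain {κ : Type*} (e : ι ↪ κ) (v : κ → M) (x : ι →₀ F) :
    tensorCombination R F (v ∘ e) x = tensorCombination R F v (x.embDomain e) := by
  induction x using Finsupp.induction_linear with
  | zero => simp
  | add x y hx hy => rw [Finsupp.embDomain_add, map_add, map_add, hx, hy]
  | single i y => simp [Finsupp.embDomain_single]

/-- If `∑ vᵢ aᵢₗ = 0` for each `l`, then `∑ᵢ vᵢ ⊗ (∑ₗ aᵢₗ zₗ) = 0`. -/
theorem sum_tmul_eq_zero (S : Finset ι) (v : ι → M) {m : ℕ} (a : ι → Fin m → R) (z : Fin m → F)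
    (h : ∀ l, ∑ i ∈ S, MulOpposite.op (a i l) • v i = 0) :
    ∑ i ∈ S, ((v i ⊗ₜ[ℤ] (∑ l, a i l • z l) : M ⊗[ℤ] F) : BalancedTensor R M F) = 0 := by
  have h1 : ∀ i, ((v i ⊗ₜ[ℤ] (∑ l, a i l • z l) : M ⊗[ℤ] F) : BalancedTensor R M F) =
      ∑ l, (((MulOpposite.op (a i l) • v i) ⊗ₜ[ℤ] z l : M ⊗[ℤ] F) : BalancedTensor R M F) := by
    intro i
    simp_rw [mk_smul_tmul]
    rw [TensorProduct.tmul_sum]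
    exact map_sum (QuotientAddGroup.mk' (balancingRelations R M F)) _ _
  simp_rw [h1]
  rw [Finset.sum_comm]
  refine Finset.sum_eq_zero fun l _ => ?_
  have h2 := map_sum (QuotientAddGroup.mk' (balancingRelations R M F))
    (fun i => (MulOpposite.op (a i l) • v i) ⊗ₜ[ℤ] z l) S
  rw [← TensorProduct.sum_tmul, h l, TensorProduct.zero_tmul, map_zero] at h2
  exact h2.symm

/-- Write the tensor as `∑ x ⊗ g x` and extend `g` by zero along `f`. Vanishing in `N ⊗ F` expresses
the extension as `∑ⱼ aⱼ yⱼ` with `∑ n aⱼ(n) = 0`. The criterion changes the `yⱼ` so that the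
coefficients at points outside the range of `f` become zero; the relations then already hold in `M`.
-/
theorem EquationalCriterion.balancedMap_injective (hF : EquationalCriterion R F)
    (f : M →ₗ[Rᵐᵒᵖ] N) (hf : Function.Injective f) :
    Function.Injective (balancedMap (R := R) F f) := by
  classical
  rw [injective_iff_map_eq_zero]
  intro z hz
  obtain ⟨g, rfl⟩ := tensorCombination_id_surjective z
  rw [balancedMap_tensorCombination] at hz
  have hz' := tensorCombination_comp_embDomain (R := R) ⟨f, hf⟩ (id : N → N) g
  have hsurj : Function.Surjective (rightCombination (R := R) (id : N → N)) :=
    fun n => ⟨Finsupp.single n 1, by simp⟩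
  obtain ⟨k, a, y, ha, hg⟩ := exists_of_mem_trivialRelations
    (mem_trivialRelations hsurj (hz'.symm.trans hz))
  let φ : (Fin k → R) →ₗ[R] F := Fintype.linearCombination R y
  let c : N → Fin k → R := fun n j => a j n
  have hφ : ∀ n, φ (c n) = g.embDomain ⟨f, hf⟩ n := by
    intro n
    rw [hg, Finsupp.finsetSum_apply]
    simp [φ, c, Fintype.linearCombination_apply]
  let U : Finset N := Finset.univ.biUnion fun j => (a j).support
  have hU : ∀ n, n ∉ U → c n = 0 := by
    intro n hn
    ext j
    by_contra h
    exact hn (Finset.mem_biUnion.2 ⟨j, Finset.mem_univ j, Finsupp.mem_support_iff.2 h⟩)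
  -- The relations to kill are the rows `c n` with `n` outside the range of `f`, where the extended
  -- family is zero.
  obtain ⟨m, ψ, χ, hχ, hψ⟩ := hF k φ ((U.filter (· ∉ Set.range f)).image c) (by
    intro t ht
    obtain ⟨n, hn, rfl⟩ := Finset.mem_image.1 ht
    rw [hφ]
    exact Finsupp.embDomain_of_notMem_range _ _ _ (Finset.mem_filter.1 hn).2)
  have hψ' : ∀ n ∈ U, n ∉ Set.range f → ψ (c n) = 0 := fun n hn hr =>
    hψ _ (Finset.mem_coe.2 (Finset.mem_image_of_mem c (Finset.mem_filter.2 ⟨hn, hr⟩)))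
  have hgm : ∀ x : M, g x = ∑ l, ψ (c (f x)) l • χ (Pi.single l 1) := by
    intro x
    have h1 : g x = φ (c (f x)) := by
      rw [hφ]
      exact (Finsupp.embDomain_apply_self ⟨f, hf⟩ g x).symm
    rw [h1, ← hχ, LinearMap.comp_apply]
    conv_lhs => rw [pi_eq_sum_univ' (ψ (c (f x))), map_sum]
    refine Finset.sum_congr rfl fun l _ => ?_
    rw [← map_smul]
  have hsupp : g.support ⊆ U.preimage f hf.injOn := by
    intro x hx
    rw [Finset.mem_preimage]
    by_contra h
    rw [Finsupp.mem_support_iff, hgm, hU _ h] at hx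
    simp at hx
  have hsum : tensorCombination R F (id : M → M) g = ∑ x ∈ U.preimage f hf.injOn,
      ((x ⊗ₜ[ℤ] g x : M ⊗[ℤ] F) : BalancedTensor R M F) := by
    refine Finset.sum_subset hsupp fun x _ hx => ?_
    rw [Finsupp.notMem_support_iff.1 hx]
    exact map_zero _
  rw [hsum]
  simp_rw [hgm]
  refine sum_tmul_eq_zero _ (id : M → M) (fun x l => ψ (c (f x)) l) _ fun l => hf ?_
  rw [map_sum, map_zero]
  simp_rw [map_smul, id]
  -- Rows outside the range of `f` are killed by `ψ`, so the sum may run over all of `U`, where the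
  -- relations `ha` apply.
  rw [Finset.sum_preimage f U hf.injOn (fun n => MulOpposite.op (ψ (c n) l) • n)
    (fun n hn hr => by simp [hψ' n hn hr])]
  have hexp : ∀ n, ψ (c n) l = ∑ j, a j n * ψ (Pi.single j 1) l := by
    intro n
    conv_lhs => rw [pi_eq_sum_univ' (c n), map_sum, Finset.sum_apply]
    refine Finset.sum_congr rfl fun j _ => ?_
    rw [map_smul, Pi.smul_apply, smul_eq_mul]
  simp_rw [hexp, Finset.op_sum, Finset.sum_smul, MulOpposite.op_mul, mul_smul]
  rw [Finset.sum_comm]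
  refine Finset.sum_eq_zero fun j _ => ?_
  rw [← Finset.smul_sum]
  have : ∑ n ∈ U, MulOpposite.op (a j n) • n = rightCombination (R := R) (id : N → N) (a j) := by
    rw [rightCombination_apply]
    refine (Finset.sum_subset (Finset.subset_biUnion_of_mem (fun j => (a j).support)
      (Finset.mem_univ j)) fun n _ hn => ?_).symm
    rw [Finsupp.notMem_support_iff.1 hn]
    simp
  rw [this, ha, smul_zero]

end Vanishing

theorem EquationalCriterion.isFlatLeftModule {R : Type u} [Ring R] {F : Type w} [AddCommGroup F]
    [Module R F] (hF : EquationalCriterion R F) : IsFlatLeftModule R F :=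
  fun _ _ _ _ _ _ f hf => hF.balancedMap_injective f hf

/-! ### Restricting a grading along an injection -/

section Decomposition

open DirectSum

variable {Γ : Type*} [DecidableEq Γ] {G H : Type*} [AddCommGroup G] [AddCommGroup H]

/-- A grading of `G` restricts to `H` along an injective homomorphism whose range contains the
homogeneous components of its elements. -/
theorem isInternal_comap (𝒢 : Γ → AddSubgroup G) [Decomposition 𝒢] (j : H →+ G)
    (hj : Function.Injective j) (h : ∀ a γ, (decompose 𝒢 (j a) γ : G) ∈ j.range) :
    DirectSum.IsInternal fun γ => (𝒢 γ).comap j := by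
  let res : ∀ γ, (𝒢 γ).comap j →+ 𝒢 γ := fun γ =>
    (j.comp ((𝒢 γ).comap j).subtype).codRestrict (𝒢 γ) fun x => x.2
  have hres : ∀ γ, Function.Injective (res γ) := fun γ x y hxy =>
    Subtype.ext (hj (congrArg Subtype.val hxy))
  have hcomp : j.comp (DirectSum.coeAddMonoidHom fun γ => (𝒢 γ).comap j) =
      (DirectSum.coeAddMonoidHom 𝒢).comp (DirectSum.map res) := by
    ext γ x
    simp only [AddMonoidHom.comp_apply, DirectSum.coeAddMonoidHom_of, DirectSum.map_of]
    rfl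
  refine ⟨?_, fun a => ?_⟩
  · have : Function.Injective (j.comp (DirectSum.coeAddMonoidHom fun γ => (𝒢 γ).comap j)) := by
      rw [hcomp]
      exact (Decomposition.isInternal 𝒢).1.comp ((DirectSum.map_injective res).2 hres)
    exact Function.Injective.of_comp this
  · classical
    choose b hb using h a
    refine ⟨∑ γ ∈ (decompose 𝒢 (j a)).support,
      DirectSum.of (fun γ => (𝒢 γ).comap j) γ ⟨b γ, ?_⟩, hj ?_⟩
    · rw [AddSubgroup.mem_comap, hb]
      exact SetLike.coe_mem _
    · rw [map_sum, map_sum]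
      simp_rw [DirectSum.coeAddMonoidHom_of, hb]
      exact DirectSum.sum_support_decompose 𝒢 (j a)

end Decomposition

/-! ### Components in graded free modules with shifted degrees -/

section ShiftedComponents

open DirectSum

variable {Γ : Type v} [AddCancelMonoid Γ] [DecidableEq Γ] {R : Type u} [Ring R]
  (𝒜 : Γ → AddSubgroup R) [GradedRing 𝒜]

open Classical in
/-- The component of degree `δ` of a ring element with respect to the shifted grading in which
the elements of `𝒜 β` have degree `β + γ`. -/
noncomputable def shiftComponent (γ δ : Γ) : R →+ R :=
  if h : ∃ β, β + γ = δ then GradedRing.proj 𝒜 h.choose else 0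

variable {𝒜} in
theorem shiftComponent_of_mem {β : Γ} {a : R} (ha : a ∈ 𝒜 β) (γ δ : Γ) :
    shiftComponent 𝒜 γ δ a = if β + γ = δ then a else 0 := by
  unfold shiftComponent
  split_ifs with h h' h'
  -- Right cancellation makes the degree `β` with `β + γ = δ` unique, so the choice is harmless.
  · have : h.choose = β := add_right_cancel (h.choose_spec.trans h'.symm)
    rw [this, GradedRing.proj_apply, decompose_of_mem_same 𝒜 ha]
  · have : β ≠ h.choose := fun e => h' (e ▸ h.choose_spec)
    rw [GradedRing.proj_apply, decompose_of_mem_ne 𝒜 ha this]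
  · exact absurd ⟨β, h'⟩ h
  · rfl

/-- The vector `t` is homogeneous of degree `δ` in the graded free module whose `i`-th basis
vector has degree `γ i`. -/
def IsShiftHomogeneous {n : ℕ} (γ : Fin n → Γ) (δ : Γ) (t : Fin n → R) : Prop :=
  ∀ i, t i = 0 ∨ ∃ β, t i ∈ 𝒜 β ∧ β + γ i = δ

theorem shiftComponent_mem (γ δ : Γ) (a : R) :
    shiftComponent 𝒜 γ δ a = 0 ∨ ∃ β, shiftComponent 𝒜 γ δ a ∈ 𝒜 β ∧ β + γ = δ := by
  unfold shiftComponent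
  split_ifs with h
  · exact Or.inr ⟨h.choose, SetLike.coe_mem _, h.choose_spec⟩
  · exact Or.inl rfl

theorem isShiftHomogeneous_shiftComponent {n : ℕ} (γ : Fin n → Γ) (δ : Γ) (t : Fin n → R) :
    IsShiftHomogeneous 𝒜 γ δ fun i => shiftComponent 𝒜 (γ i) δ (t i) :=
  fun i => shiftComponent_mem 𝒜 (γ i) δ (t i)

variable {𝒜} in
/-- Multiplication by an element of degree `α` commutes with taking components. -/
theorem shiftComponent_mul {α γ δ ε : Γ} {r : R} (hr : r ∈ 𝒜 α) (h : α + γ = δ) (a : R) :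
    shiftComponent 𝒜 ε δ (r * a) = r * shiftComponent 𝒜 ε γ a := by
  induction a using Decomposition.inductionOn 𝒜 with
  | zero => simp
  | add a b ha hb => rw [mul_add, map_add, map_add, mul_add, ha, hb]
  | @homogeneous β a =>
    rw [shiftComponent_of_mem (SetLike.mul_mem_graded hr a.2), shiftComponent_of_mem a.2,
      ← h, add_assoc]
    -- Left cancellation: prefixing `α` does not merge distinct degrees.
    simp only [add_right_inj]
    split_ifs <;> simp

variable {F : Type*} [AddCommGroup F] [Module R F] (ℱ : Γ → AddSubgroup F)
  [Decomposition ℱ] [SetLike.GradedSMul 𝒜 ℱ]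

variable {ℱ} in
theorem decompose_smul_of_mem {ε : Γ} {y : F} (hy : y ∈ ℱ ε) (a : R) (γ : Γ) :
    (decompose ℱ (a • y) γ : F) = shiftComponent 𝒜 ε γ a • y := by
  induction a using Decomposition.inductionOn 𝒜 with
  | zero => simp
  | add a b ha hb =>
    rw [add_smul, decompose_add, DirectSum.add_apply, AddSubgroup.coe_add, ha, hb, map_add,
      add_smul]
  | @homogeneous β a =>
    have hm : (a : R) • y ∈ ℱ (β + ε) := SetLike.GradedSMul.smul_mem a.2 hy
    rw [shiftComponent_of_mem a.2]
    split_ifs with h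
    · rw [← h, decompose_of_mem_same ℱ hm]
    · rw [decompose_of_mem_ne ℱ hm h, zero_smul]

/-- The finitely many homogeneous components of a vector add up to it. -/
theorem exists_sum_shiftComponent {n : ℕ} (γ : Fin n → Γ) (t : Fin n → R) :
    ∃ D : Finset Γ, t = ∑ δ ∈ D, fun i => shiftComponent 𝒜 (γ i) δ (t i) := by
  classical
  -- Allowing every larger `D'` lets one finite set serve all coordinates at once.
  have key : ∀ (γ : Γ) (a : R), ∃ D : Finset Γ, ∀ D', D ⊆ D' →
      a = ∑ δ ∈ D', shiftComponent 𝒜 γ δ a := by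
    intro γ a
    induction a using Decomposition.inductionOn 𝒜 with
    | zero => exact ⟨∅, fun _ _ => by simp⟩
    | add a b ha hb =>
      obtain ⟨D, hD⟩ := ha
      obtain ⟨E, hE⟩ := hb
      refine ⟨D ∪ E, fun D' h => ?_⟩
      simp_rw [map_add, Finset.sum_add_distrib]
      rw [← hD D' (Finset.union_subset_left h), ← hE D' (Finset.union_subset_right h)]
    | @homogeneous β a =>
      refine ⟨{β + γ}, fun D' h => ?_⟩
      simp_rw [shiftComponent_of_mem a.2]
      rw [Finset.sum_ite_eq, if_pos (h (Finset.mem_singleton_self _))]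
  choose D hD using fun i => key (γ i) (t i)
  refine ⟨Finset.univ.biUnion D, ?_⟩
  ext i
  rw [Finset.sum_apply]
  exact hD i _ (Finset.subset_biUnion_of_mem D (Finset.mem_univ i))

variable {𝒜} in
theorem IsShiftHomogeneous.map {n m : ℕ} {γ : Fin n → Γ} {ε : Fin m → Γ} {δ : Γ}
    {ψ : (Fin n → R) →ₗ[R] (Fin m → R)}
    (hψ : ∀ i, IsShiftHomogeneous 𝒜 ε (γ i) (ψ (Pi.single i 1))) {t : Fin n → R}
    (ht : IsShiftHomogeneous 𝒜 γ δ t) : IsShiftHomogeneous 𝒜 ε δ (ψ t) := by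
  intro j
  have hexp : ψ t j = ∑ i, t i * ψ (Pi.single i 1) j := by
    conv_lhs => rw [pi_eq_sum_univ' t, map_sum, Finset.sum_apply]
    exact Finset.sum_congr rfl fun i _ => by rw [map_smul, Pi.smul_apply, smul_eq_mul]
  have hterm : ∀ i, shiftComponent 𝒜 (ε j) δ (t i * ψ (Pi.single i 1) j) =
      t i * ψ (Pi.single i 1) j := by
    intro i
    rcases ht i with h | ⟨α, hα, hαδ⟩
    · rw [h, zero_mul, map_zero]
    · rw [shiftComponent_mul hα hαδ]
      rcases hψ i j with h | ⟨β, hβ, hβγ⟩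
      · rw [h, map_zero]
      · rw [shiftComponent_of_mem hβ, if_pos hβγ]
  have : shiftComponent 𝒜 (ε j) δ (ψ t j) = ψ t j := by
    rw [hexp, map_sum]
    exact Finset.sum_congr rfl fun i _ => hterm i
  rw [← this]
  exact shiftComponent_mem 𝒜 (ε j) δ (ψ t j)

theorem decompose_apply_shiftComponent {n : ℕ} {γ : Fin n → Γ} {φ : (Fin n → R) →ₗ[R] F}
    (hφ : ∀ i, φ (Pi.single i 1) ∈ ℱ (γ i)) (t : Fin n → R) (δ : Γ) :
    (decompose ℱ (φ t) δ : F) = φ fun i => shiftComponent 𝒜 (γ i) δ (t i) := by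
  have hexp : ∀ s : Fin n → R, φ s = ∑ i, s i • φ (Pi.single i 1) := by
    intro s
    conv_lhs => rw [pi_eq_sum_univ' s, map_sum]
    exact Finset.sum_congr rfl fun i _ => by rw [map_smul]
  rw [hexp t, hexp, decompose_sum, DFinsupp.finsetSum_apply, AddSubgroup.val_finsetSum]
  exact Finset.sum_congr rfl fun i _ => decompose_smul_of_mem 𝒜 (hφ i) _ _

end ShiftedComponents

/-! ### From one homogeneous relation to the full criterion -/

section HomogeneousCriterion

open DirectSum

/-- Every homomorphism from a finite free module factors through a finite free module whose basis
is mapped to homogeneous elements. -/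
theorem exists_factorization_homogeneous {Γ R : Type*} [DecidableEq Γ] [Ring R] {F : Type*}
    [AddCommGroup F] [Module R F] (ℱ : Γ → AddSubgroup F) [Decomposition ℱ] {n : ℕ} (φ : (Fin n → R) →ₗ[R] F) :
    ∃ (m : ℕ) (ε : Fin m → Γ) (ψ : (Fin n → R) →ₗ[R] (Fin m → R)) (χ : (Fin m → R) →ₗ[R] F),
      (∀ j, χ (Pi.single j 1) ∈ ℱ (ε j)) ∧ χ ∘ₗ ψ = φ := by
  classical
  -- One new basis vector for each nonzero homogeneous component of each `φ(eᵢ)`; `ψ` sends `eᵢ` to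
  -- the sum of those belonging to `i`.
  let I := Σ i : Fin n, {γ // γ ∈ (decompose ℱ (φ (Pi.single i 1))).support}
  let e := Fintype.equivFin I
  let y : I → F := fun p => decompose ℱ (φ (Pi.single p.1 1)) p.2
  let χ := Fintype.linearCombination R (y ∘ e.symm)
  have hχ : ∀ j, χ (Pi.single j 1) = y (e.symm j) := fun j => by
    simp [χ, Fintype.linearCombination_apply_single]
  refine ⟨Fintype.card I, fun j => (e.symm j).2,
    Fintype.linearCombination R fun i => ∑ γ, Pi.single (e ⟨i, γ⟩) 1, χ, fun j => ?_, ?_⟩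
  · rw [hχ]
    exact SetLike.coe_mem _
  · refine (Pi.basisFun R (Fin n)).ext fun i => ?_
    rw [Pi.basisFun_apply, LinearMap.comp_apply, Fintype.linearCombination_apply_single, one_smul,
      map_sum]
    simp_rw [hχ, Equiv.symm_apply_apply]
    conv_rhs => rw [← sum_support_decompose ℱ (φ (Pi.single i 1))]
    exact Finset.sum_coe_sort _ fun γ => (decompose ℱ (φ (Pi.single i 1)) γ : F)

variable {Γ : Type v} [AddCancelMonoid Γ] [DecidableEq Γ] {R : Type u} [Ring R]
  (𝒜 : Γ → AddSubgroup R) [GradedRing 𝒜]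

/-- The equational criterion for a single homogeneous relation between homogeneous elements. -/
def HomogeneousEquationalCriterion {F : Type*} [AddCommGroup F] [Module R F]
    (ℱ : Γ → AddSubgroup F) : Prop :=
  ∀ (n : ℕ) (γ : Fin n → Γ) (φ : (Fin n → R) →ₗ[R] F) (δ : Γ) (t : Fin n → R),
    (∀ i, φ (Pi.single i 1) ∈ ℱ (γ i)) → IsShiftHomogeneous 𝒜 γ δ t → φ t = 0 →
    FactorsThroughFree φ {t}

/-- The homomorphism `φ` from the graded free module `Rⁿ` to `F` factors through a graded
finite free module in such a way that the elements of `T` are killed by the first factor. -/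
def FactorsThroughGradedFree {F : Type*} [AddCommGroup F] [Module R F] (ℱ : Γ → AddSubgroup F)
    {n : ℕ} (γ : Fin n → Γ) (φ : (Fin n → R) →ₗ[R] F) (T : Set (Fin n → R)) : Prop :=
  ∃ (m : ℕ) (ε : Fin m → Γ) (ψ : (Fin n → R) →ₗ[R] (Fin m → R)) (χ : (Fin m → R) →ₗ[R] F),
    (∀ i, IsShiftHomogeneous 𝒜 ε (γ i) (ψ (Pi.single i 1))) ∧
    (∀ j, χ (Pi.single j 1) ∈ ℱ (ε j)) ∧ χ ∘ₗ ψ = φ ∧ ∀ t ∈ T, ψ t = 0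

variable {F : Type*} [AddCommGroup F] [Module R F] (ℱ : Γ → AddSubgroup F)
  [Decomposition ℱ] [SetLike.GradedSMul 𝒜 ℱ]

variable {𝒜 ℱ} in
/-- In the homogeneous equational criterion one may factor through a graded free module. -/
theorem HomogeneousEquationalCriterion.factorsThroughGradedFree
    (h : HomogeneousEquationalCriterion 𝒜 ℱ) {n : ℕ} {γ : Fin n → Γ} {φ : (Fin n → R) →ₗ[R] F}
    {δ : Γ} {t : Fin n → R} (hφ : ∀ i, φ (Pi.single i 1) ∈ ℱ (γ i))
    (ht : IsShiftHomogeneous 𝒜 γ δ t) (h0 : φ t = 0) :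
    FactorsThroughGradedFree 𝒜 ℱ γ φ {t} := by
  obtain ⟨m', ψ', χ', rfl, hψ'⟩ := h n γ φ δ t hφ ht h0
  obtain ⟨m, ε, ψ'', χ, hχ, rfl⟩ := exists_factorization_homogeneous ℱ χ'
  let a : Fin n → Fin m → R := fun i => ψ'' (ψ' (Pi.single i 1))
  -- Each matrix entry is cut down to its component of the right degree. This preserves the
  -- composite because `φ(eᵢ)` has degree `γ i`, and it preserves `ψ t = 0` because that equation is
  -- only replaced by its degree `δ` component.
  let ψ : (Fin n → R) →ₗ[R] (Fin m → R) := Fintype.linearCombination R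
    fun i j => shiftComponent 𝒜 (ε j) (γ i) (a i j)
  have hψ : ∀ i, ψ (Pi.single i 1) = fun j => shiftComponent 𝒜 (ε j) (γ i) (a i j) := fun i => by
    simp [ψ, Fintype.linearCombination_apply_single]
  refine ⟨m, ε, ψ, χ, fun i => ?_, hχ, ?_, ?_⟩
  · rw [hψ]
    exact isShiftHomogeneous_shiftComponent 𝒜 ε (γ i) (a i)
  · refine (Pi.basisFun R (Fin n)).ext fun i => ?_
    rw [Pi.basisFun_apply, LinearMap.comp_apply, hψ,
      ← decompose_apply_shiftComponent 𝒜 ℱ hχ (a i) (γ i)]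
    exact decompose_of_mem_same ℱ (hφ i)
  · intro t' ht'
    rw [Set.mem_singleton_iff.1 ht']
    ext j
    have h1 : ψ t j = ∑ i, t i * shiftComponent 𝒜 (ε j) (γ i) (a i j) := by
      simp [ψ, Fintype.linearCombination_apply]
    have h2 : ∑ i, t i * a i j = 0 := by
      have h3 : ψ'' (ψ' t) j = ∑ i, t i * a i j := by
        conv_lhs => rw [pi_eq_sum_univ' t, map_sum, map_sum, Finset.sum_apply]
        exact Finset.sum_congr rfl fun i _ => by
          rw [map_smul, map_smul, Pi.smul_apply, smul_eq_mul]
      rw [← h3, hψ' t rfl, map_zero, Pi.zero_apply]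
    have h4 : ∀ i, t i * shiftComponent 𝒜 (ε j) (γ i) (a i j) =
        shiftComponent 𝒜 (ε j) δ (t i * a i j) := by
      intro i
      rcases ht i with h | ⟨α, hα, hαδ⟩
      · rw [h, zero_mul, zero_mul, map_zero]
      · rw [shiftComponent_mul hα hαδ]
    rw [h1, Finset.sum_congr rfl fun i _ => h4 i, ← map_sum, h2, map_zero, Pi.zero_apply]

-- Relations are killed one at a time. The factorization must be graded so that the image of the
-- next relation is again homogeneous.
variable {𝒜 ℱ} in
theorem HomogeneousEquationalCriterion.factorsThroughGradedFree_finset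
    (h : HomogeneousEquationalCriterion 𝒜 ℱ) {n : ℕ} {γ : Fin n → Γ} {φ : (Fin n → R) →ₗ[R] F}
    (hφ : ∀ i, φ (Pi.single i 1) ∈ ℱ (γ i)) (T : Finset (Fin n → R))
    (hT : ∀ t ∈ T, (∃ δ, IsShiftHomogeneous 𝒜 γ δ t) ∧ φ t = 0) :
    FactorsThroughGradedFree 𝒜 ℱ γ φ (T : Set (Fin n → R)) := by
  classical
  induction T using Finset.induction_on with
  | empty =>
    refine ⟨n, γ, LinearMap.id, φ, fun i j => ?_, hφ, LinearMap.comp_id φ, by simp⟩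
    rw [LinearMap.id_apply]
    by_cases hij : j = i
    · subst hij
      exact Or.inr ⟨0, by simpa using SetLike.one_mem_graded 𝒜, zero_add _⟩
    · exact Or.inl (Pi.single_eq_of_ne hij 1)
  | insert t T _ ih =>
    obtain ⟨m, ε, ψ, χ, hψ, hχ, hcomp, hk⟩ := ih fun s hs => hT s (Finset.mem_insert_of_mem hs)
    obtain ⟨⟨δ, hδ⟩, h0⟩ := hT t (Finset.mem_insert_self _ _)
    obtain ⟨m', ε', ψ', χ', hψ', hχ', hcomp', hk'⟩ := h.factorsThroughGradedFree hχ (hδ.map hψ)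
      (by rw [← LinearMap.comp_apply, hcomp, h0])
    refine ⟨m', ε', ψ' ∘ₗ ψ, χ', fun i => (hψ i).map hψ', hχ', ?_, fun s hs => ?_⟩
    · rw [← LinearMap.comp_assoc, hcomp', hcomp]
    · rw [LinearMap.comp_apply]
      rcases Finset.mem_insert.1 (Finset.mem_coe.1 hs) with rfl | hs
      · exact hk' _ rfl
      · rw [hk s hs, map_zero]

variable {𝒜 ℱ} in
/-- For graded modules the homogeneous equational criterion implies the full one. -/
theorem HomogeneousEquationalCriterion.equationalCriterion
    (h : HomogeneousEquationalCriterion 𝒜 ℱ) : EquationalCriterion R F := by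
  classical
  intro n φ T hT
  obtain ⟨m, ε, ψ, χ, hχ, rfl⟩ := exists_factorization_homogeneous ℱ φ
  choose D hD using exists_sum_shiftComponent 𝒜 ε
  -- `χ` preserves degrees, so each homogeneous component of `ψ t` is itself a relation.
  obtain ⟨m', _, ψ', χ', _, _, hcomp, hk⟩ := h.factorsThroughGradedFree_finset hχ
    (T.biUnion fun t => (D (ψ t)).image fun δ i => shiftComponent 𝒜 (ε i) δ (ψ t i)) (by
      intro s hs
      obtain ⟨t, ht, hs⟩ := Finset.mem_biUnion.1 hs
      obtain ⟨δ, _, rfl⟩ := Finset.mem_image.1 hs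
      refine ⟨⟨δ, isShiftHomogeneous_shiftComponent 𝒜 ε δ (ψ t)⟩, ?_⟩
      rw [← decompose_apply_shiftComponent 𝒜 ℱ hχ (ψ t) δ, ← LinearMap.comp_apply, hT t ht]
      simp)
  refine ⟨m', ψ' ∘ₗ ψ, χ', by rw [← LinearMap.comp_assoc, hcomp], fun t ht => ?_⟩
  rw [LinearMap.comp_apply, hD (ψ t), map_sum]
  refine Finset.sum_eq_zero fun δ hδ => hk _ ?_
  exact Finset.mem_coe.2 (Finset.mem_biUnion.2 ⟨t, ht, Finset.mem_image_of_mem _ hδ⟩)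

end HomogeneousCriterion

/-! ### Gr-flat modules satisfy the homogeneous criterion -/

section GradedFlat

open DirectSum

variable {Γ : Type v} [AddCancelMonoid Γ] [DecidableEq Γ] {R : Type u} [Ring R]
  {𝒜 : Γ → AddSubgroup R}

theorem IsFlatLeftModule.isGradedFlat {F : Type w} [AddCommGroup F] [Module R F]
    (h : IsFlatLeftModule R F) : IsGradedFlat 𝒜 F :=
  fun M N _ _ _ _ _ _ _ _ f _ hf => h M N f hf

variable [GradedRing 𝒜]

/-- A right ideal generated by homogeneous elements contains the homogeneous components of its
elements. -/
theorem decompose_rightCombination_mem {n : ℕ} {t : Fin n → R}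
    (ht : ∀ i, SetLike.IsHomogeneousElem 𝒜 (t i)) (a : Fin n →₀ R) (γ : Γ) :
    (decompose 𝒜 (rightCombination t a) γ : R) ∈ (rightCombination (R := R) t).range := by
  induction a using Finsupp.induction_linear with
  | zero => simp
  | add a b ha hb =>
    rw [map_add, decompose_add, DirectSum.add_apply, AddSubgroup.coe_add]
    exact add_mem ha hb
  | single i s =>
    obtain ⟨α, hα⟩ := ht i
    rw [rightCombination_single, MulOpposite.smul_eq_mul_unop, MulOpposite.unop_op]
    induction s using Decomposition.inductionOn 𝒜 with
    | zero => simp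
    | add r s hr hs =>
      rw [mul_add, decompose_add, DirectSum.add_apply, AddSubgroup.coe_add]
      exact add_mem hr hs
    | @homogeneous β s =>
      have hm := SetLike.mul_mem_graded hα s.2
      by_cases h : α + β = γ
      · subst h
        rw [decompose_of_mem_same 𝒜 hm]
        exact ⟨Finsupp.single i s, by simp⟩
      · rw [decompose_of_mem_ne 𝒜 hm h]
        exact zero_mem _

/-- The coefficients of a trivial vanishing form the matrix of the first factor and the elements
`yⱼ` define the second. Applying `f` to `∑ vᵢ aⱼ(i) = 0` shows that `t` is killed. -/
theorem FactorsThroughFree.of_mem_trivialRelations {M : Type*} [AddCommGroup M] [Module Rᵐᵒᵖ M]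
    {F : Type*} [AddCommGroup F] [Module R F] {n : ℕ} {φ : (Fin n → R) →ₗ[R] F} {t : Fin n → R}
    {v : Fin n → M} (f : M →ₗ[Rᵐᵒᵖ] R) (hf : ∀ i, f (v i) = t i)
    (h : Finsupp.equivFunOnFinite.symm (fun i => φ (Pi.single i 1)) ∈ trivialRelations R F v) :
    FactorsThroughFree φ {t} := by
  obtain ⟨k, a, y, ha, hx⟩ := exists_of_mem_trivialRelations h
  refine ⟨k, Fintype.linearCombination R fun i j => a j i, Fintype.linearCombination R y, ?_, ?_⟩
  · refine (Pi.basisFun R (Fin n)).ext fun i => ?_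
    rw [Pi.basisFun_apply, LinearMap.comp_apply, Fintype.linearCombination_apply_single, one_smul]
    have := DFunLike.congr_fun hx i
    rw [Finsupp.finsetSum_apply] at this
    simpa [Fintype.linearCombination_apply] using this.symm
  · rintro _ rfl
    ext j
    have := congrArg f (ha j)
    rw [rightCombination_apply, map_zero, Finsupp.sum_fintype _ _ (by simp), map_sum] at this
    simpa [Fintype.linearCombination_apply, hf] using this

/-- A gr-flat module satisfies the homogeneous equational criterion. -/
theorem IsGradedFlat.homogeneousEquationalCriterion {F : Type w} [AddCommGroup F] [Module R F]
    (h : IsGradedFlat 𝒜 F) (ℱ : Γ → AddSubgroup F) : HomogeneousEquationalCriterion 𝒜 ℱ := by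
  intro n γ φ δ t _ ht h0
  have ht' : ∀ i, SetLike.IsHomogeneousElem 𝒜 (t i) := by
    intro i
    rcases ht i with h | ⟨β, hβ, -⟩
    · exact ⟨0, h ▸ zero_mem _⟩
    · exact ⟨β, hβ⟩
  -- The test map is the inclusion of the right ideal generated by the coordinates of `t`; `ULift`
  -- only adjusts universes.
  let J : Submodule Rᵐᵒᵖ R := Submodule.span Rᵐᵒᵖ (Set.range t)
  let f : ULift.{w} J →ₗ[Rᵐᵒᵖ] ULift.{w} R :=
    ULift.moduleEquiv.symm.toLinearMap ∘ₗ J.subtype ∘ₗ ULift.moduleEquiv.toLinearMap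
  let g : ULift.{w} R →ₗ[Rᵐᵒᵖ] R := ULift.moduleEquiv.toLinearMap
  have hg : Function.Injective g := ULift.moduleEquiv.injective
  have hf : Function.Injective f := fun a b hab =>
    ULift.ext _ _ (Subtype.ext (congrArg ULift.down hab))
  have hrange : ∀ a : ULift.{w} J, ∃ b : Fin n →₀ R, rightCombination t b = g (f a) := by
    rintro ⟨a, ha⟩
    change ∃ b : Fin n →₀ R, rightCombination t b = a
    induction ha using Submodule.span_induction with
    | mem x hx =>
      obtain ⟨i, rfl⟩ := hx
      exact ⟨Finsupp.single i 1, by simp⟩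
    | zero => exact ⟨0, map_zero _⟩
    | add x y _ _ hx hy =>
      obtain ⟨b, rfl⟩ := hx
      obtain ⟨c, rfl⟩ := hy
      exact ⟨b + c, map_add _ _ _⟩
    | smul r x _ hx =>
      obtain ⟨b, rfl⟩ := hx
      exact ⟨_, rightCombination_mul t b r.unop⟩
  let s : Fin n → ULift.{w} J := fun i => ⟨t i, Submodule.subset_span ⟨i, rfl⟩⟩
  have hs : ∀ b : Fin n →₀ R, g (f (rightCombination s b)) = rightCombination t b := by
    intro b
    rw [rightCombination_apply, rightCombination_apply, map_finsuppSum, map_finsuppSum]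
    rfl
  have hs_surj : Function.Surjective (rightCombination (R := R) s) := by
    intro a
    obtain ⟨b, hb⟩ := hrange a
    exact ⟨b, hf (hg ((hs b).trans hb))⟩
  have hsmul : ∀ ⦃α β : Γ⦄ ⦃r x : R⦄, r ∈ 𝒜 α → x ∈ 𝒜 β → MulOpposite.op r • x ∈ 𝒜 (β + α) :=
    fun α β r x hr hx => SetLike.mul_mem_graded hx hr
  have hJ : IsGradedRightModule 𝒜 fun γ => (𝒜 γ).comap (g ∘ₗ f).toAddMonoidHom := by
    refine ⟨isInternal_comap 𝒜 _ (hg.comp hf) fun a γ => ?_, fun α β r m hr hm => ?_⟩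
    · obtain ⟨b, hb⟩ := hrange a
      obtain ⟨c, hc⟩ := decompose_rightCombination_mem ht' b γ
      refine ⟨rightCombination s c, (hs c).trans (hc.trans ?_)⟩
      rw [hb]
      rfl
    · rw [AddSubgroup.mem_comap] at hm ⊢
      have := hsmul hr hm
      rwa [LinearMap.toAddMonoidHom_coe, map_smul]
  have hR : IsGradedRightModule 𝒜 fun γ => (𝒜 γ).comap g.toAddMonoidHom := by
    refine ⟨isInternal_comap 𝒜 _ hg fun a γ => ⟨ULift.up _, rfl⟩, fun α β r m hr hm => ?_⟩
    rw [AddSubgroup.mem_comap] at hm ⊢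
    exact hsmul hr hm
  have hinj := h _ _ _ _ hJ hR f (fun γ x hx => hx) hf
  -- In `R ⊗ F` the sum `∑ tᵢ ⊗ φ(eᵢ)` equals `1 ⊗ φ(t) = 0`; gr-flatness moves this vanishing to `J
  -- ⊗ F`.
  refine FactorsThroughFree.of_mem_trivialRelations (v := s) (g ∘ₗ f) (fun i => rfl)
    (mem_trivialRelations hs_surj (hinj ?_))
  have hfs : f ∘ s = fun i => MulOpposite.op (t i) • (ULift.up 1 : ULift.{w} R) := by
    funext i
    exact hg (by change t i = 1 * t i; rw [one_mul])
  rw [balancedMap_tensorCombination, map_zero, hfs]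
  have hsum : tensorCombination R F (fun i => MulOpposite.op (t i) • (ULift.up 1 : ULift.{w} R))
      (Finsupp.equivFunOnFinite.symm fun i => φ (Pi.single i 1)) =
      ∑ i, ((((ULift.up 1 : ULift.{w} R)) ⊗ₜ[ℤ] (t i • φ (Pi.single i 1)) : ULift.{w} R ⊗[ℤ] F) :
        BalancedTensor R (ULift.{w} R) F) := by
    refine (Finsupp.sum_fintype _ _ (fun i => map_zero _)).trans ?_
    exact Finset.sum_congr rfl fun i _ => mk_smul_tmul _ _ _
  have hφt : ∑ i, t i • φ (Pi.single i 1) = 0 := by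
    rw [← h0]
    conv_rhs => rw [pi_eq_sum_univ' t, map_sum]
    exact Finset.sum_congr rfl fun i _ => by rw [map_smul]
  rw [hsum]
  refine (map_sum (QuotientAddGroup.mk' (balancingRelations R (ULift.{w} R) F))
    (fun i => (ULift.up 1 : ULift.{w} R) ⊗ₜ[ℤ] (t i • φ (Pi.single i 1))) _).symm.trans ?_
  rw [← TensorProduct.tmul_sum, hφt, TensorProduct.tmul_zero, map_zero]

end GradedFlat

/-! ### Graded semihereditary rings: splitting images and passing to submodules -/

section Semihereditary

open DirectSum

theorem isGradedSubmodule_range_coordinate {Γ : Type*} [AddCancelMonoid Γ] {R : Type*} [Ring R]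
    {𝒜 : Γ → AddSubgroup R} {n m : ℕ} {γ : Fin n → Γ} {ε : Fin m → Γ}
    {ψ : (Fin n → R) →ₗ[R] (Fin m → R)}
    (hψ : ∀ i, IsShiftHomogeneous 𝒜 ε (γ i) (ψ (Pi.single i 1))) (j : Fin m) :
    IsGradedSubmodule 𝒜 (LinearMap.range (LinearMap.proj j ∘ₗ ψ) : Submodule R R) := by
  refine ⟨Set.range fun i => ψ (Pi.single i 1) j, ?_, ?_⟩
  · rintro _ ⟨i, rfl⟩
    rcases hψ i j with h | ⟨β, hβ, -⟩
    · exact ⟨0, by simp only [h]; exact zero_mem _⟩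
    · exact ⟨β, hβ⟩
  · rw [LinearMap.range_eq_map, ← (Pi.basisFun R (Fin n)).span_eq, Submodule.map_span,
      ← Set.range_comp]
    congr 2
    funext i
    simp

theorem IsGradedLeftSemihereditary.isGradedLeftCoherent {Γ R : Type*} [Ring R]
    {𝒜 : Γ → AddSubgroup R} (h : IsGradedLeftSemihereditary 𝒜) :
    IsGradedLeftCoherent 𝒜 := by
  intro I hI hI'
  have := h I hI hI'
  have := Module.Finite.iff_fg.2 hI
  exact Module.finitePresentation_of_projective R I

variable {Γ : Type v} [AddCancelMonoid Γ] [DecidableEq Γ] {R : Type u} [Ring R]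
  {𝒜 : Γ → AddSubgroup R} [GradedRing 𝒜]

theorem shiftComponent_mul_of_mem {β γ ε : Γ} {a : R} (ha : a ∈ 𝒜 β) (h : β + ε = γ) (δ : Γ)
    (r : R) : shiftComponent 𝒜 ε δ (r * a) = shiftComponent 𝒜 γ δ r * a := by
  induction r using Decomposition.inductionOn 𝒜 with
  | zero => simp
  | add r s hr hs => rw [add_mul, map_add, map_add, add_mul, hr, hs]
  | @homogeneous α r =>
    rw [shiftComponent_of_mem (SetLike.mul_mem_graded r.2 ha), shiftComponent_of_mem r.2,
      add_assoc, h]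
    split_ifs <;> simp

theorem shiftComponent_map {n m : ℕ} {γ : Fin n → Γ} {ε : Fin m → Γ}
    {ψ : (Fin n → R) →ₗ[R] (Fin m → R)}
    (hψ : ∀ i, IsShiftHomogeneous 𝒜 ε (γ i) (ψ (Pi.single i 1))) (t : Fin n → R) (δ : Γ)
    (j : Fin m) :
    shiftComponent 𝒜 (ε j) δ (ψ t j) = ψ (fun i => shiftComponent 𝒜 (γ i) δ (t i)) j := by
  have hexp : ∀ t, ψ t j = ∑ i, t i * ψ (Pi.single i 1) j := by
    intro t
    conv_lhs => rw [pi_eq_sum_univ' t, map_sum, Finset.sum_apply]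
    exact Finset.sum_congr rfl fun i _ => by rw [map_smul, Pi.smul_apply, smul_eq_mul]
  rw [hexp, hexp, map_sum]
  refine Finset.sum_congr rfl fun i _ => ?_
  rcases hψ i j with h | ⟨β, hβ, hβγ⟩
  · rw [h, mul_zero, mul_zero, map_zero]
  · rw [shiftComponent_mul_of_mem hβ hβγ]

/-- If it is finitely generated, the kernel of a coordinate of a degree-preserving homomorphism is the image of
a degree-preserving homomorphism from a graded finite free module. -/
theorem exists_graded_presentation_ker {n m : ℕ} {γ : Fin n → Γ} {ε : Fin m → Γ}
    {ψ : (Fin n → R) →ₗ[R] (Fin m → R)}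
    (hψ : ∀ i, IsShiftHomogeneous 𝒜 ε (γ i) (ψ (Pi.single i 1))) (j : Fin m)
    (hK : (LinearMap.ker (LinearMap.proj j ∘ₗ ψ)).FG) :
    ∃ (q : ℕ) (η : Fin q → Γ) (θ : (Fin q → R) →ₗ[R] (Fin n → R)),
      (∀ i, IsShiftHomogeneous 𝒜 γ (η i) (θ (Pi.single i 1))) ∧
      LinearMap.range θ = LinearMap.ker (LinearMap.proj j ∘ₗ ψ) := by
  let S : Set (Fin n → R) := {t | (∃ δ, IsShiftHomogeneous 𝒜 γ δ t) ∧ ψ t j = 0}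
  have hS : LinearMap.ker (LinearMap.proj j ∘ₗ ψ) = Submodule.span R S := by
    refine le_antisymm (fun t ht => ?_) (Submodule.span_le.2 fun t ht => ht.2)
    obtain ⟨D, hD⟩ := exists_sum_shiftComponent 𝒜 γ t
    rw [hD]
    refine Submodule.sum_mem _ fun δ _ => Submodule.subset_span
      ⟨⟨δ, isShiftHomogeneous_shiftComponent 𝒜 γ δ t⟩, ?_⟩
    have h0 : ψ t j = 0 := ht
    rw [← shiftComponent_map hψ, h0, map_zero]
  obtain ⟨S', hS', hspan⟩ := (Submodule.fg_span_iff_fg_span_finset_subset S).1 (hS ▸ hK)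
  choose η hη using fun s : S' => (hS' s.2).1
  let e := S'.equivFin
  refine ⟨S'.card, fun i => η (e.symm i),
    Fintype.linearCombination R fun i => (e.symm i : Fin n → R), fun i => ?_, ?_⟩
  · rw [Fintype.linearCombination_apply_single, one_smul]
    exact hη _
  · rw [Fintype.range_linearCombination, hS, hspan]
    congr 1
    ext x
    exact ⟨fun ⟨i, hi⟩ => hi ▸ (e.symm i).2, fun hx => ⟨e ⟨x, hx⟩, by simp⟩⟩

/-- Over a graded left semihereditary ring, the image of a degree-preserving homomorphism between
graded finite free modules splits off. -/
theorem IsGradedLeftSemihereditary.exists_retraction (h : IsGradedLeftSemihereditary 𝒜) {m : ℕ} :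
    ∀ {n : ℕ} {γ : Fin n → Γ} {ε : Fin m → Γ} {ψ : (Fin n → R) →ₗ[R] (Fin m → R)},
    (∀ i, IsShiftHomogeneous 𝒜 ε (γ i) (ψ (Pi.single i 1))) →
    ∃ π : (Fin n → R) →ₗ[R] (Fin n → R),
      LinearMap.ker ψ ≤ LinearMap.ker π ∧ ψ ∘ₗ π = ψ := by
  induction m with
  | zero => exact fun {n γ ε ψ} _ => ⟨0, by simp, Subsingleton.elim _ _⟩
  | succ m ih =>
    intro n γ ε ψ hψ
    -- Split off the first coordinate: its image is a finitely generated homogeneous left ideal,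
    -- hence projective, and a section yields `π₁`.
    let p : (Fin n → R) →ₗ[R] R := LinearMap.proj 0 ∘ₗ ψ
    have hproj : Module.Projective R (LinearMap.range p) :=
      h (LinearMap.range p) (Module.Finite.iff_fg.1 inferInstance)
        (isGradedSubmodule_range_coordinate hψ 0)
    obtain ⟨s, hs⟩ := p.rangeRestrict.exists_rightInverse_of_surjective
      (LinearMap.range_eq_top.2 p.surjective_rangeRestrict)
    let π₁ : (Fin n → R) →ₗ[R] (Fin n → R) := s ∘ₗ p.rangeRestrict
    have hpπ₁ : ∀ x, p (π₁ x) = p x := fun x =>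
      congrArg Subtype.val (LinearMap.congr_fun hs (p.rangeRestrict x))
    have hπ₁ : ∀ x, p x = 0 → π₁ x = 0 := by
      intro x hx
      have : p.rangeRestrict x = 0 := Subtype.ext hx
      rw [LinearMap.comp_apply, this, map_zero]
    have hker : LinearMap.ker p = LinearMap.range (LinearMap.id - π₁) := by
      apply le_antisymm
      · intro x hx
        refine ⟨x, ?_⟩
        rw [LinearMap.sub_apply, hπ₁ x hx, sub_zero, LinearMap.id_apply]
      · rintro _ ⟨x, rfl⟩
        rw [LinearMap.mem_ker, LinearMap.sub_apply, map_sub, hpπ₁, LinearMap.id_apply, sub_self]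
    -- The section is not required to preserve degrees, so neither is `id - π₁`. A graded cover `θ`
    -- of `ker p` restores the hypothesis needed for induction.
    obtain ⟨q, η, θ, hθ, hrange⟩ := exists_graded_presentation_ker hψ 0
      (show (LinearMap.ker p).FG from hker ▸ Module.Finite.iff_fg.1 inferInstance)
    have hpθ : ∀ y, ψ (θ y) 0 = 0 := fun y => by
      have : θ y ∈ LinearMap.ker p := hrange ▸ ⟨y, rfl⟩
      exact this
    obtain ⟨μ, hμ⟩ := Module.projective_lifting_property θ.rangeRestrict
      ((LinearMap.id - π₁).codRestrict (LinearMap.range θ) fun x => by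
        rw [hrange]
        exact hker.ge ⟨x, rfl⟩) θ.surjective_rangeRestrict
    have hμ' : ∀ x, θ (μ x) = x - π₁ x := fun x =>
      congrArg Subtype.val (LinearMap.congr_fun hμ x)
    obtain ⟨π₂, hπ₂, hψπ₂⟩ := ih (n := q) (γ := η) (ε := fun j => ε j.succ)
      (ψ := LinearMap.funLeft R R Fin.succ ∘ₗ ψ ∘ₗ θ) fun i j => (hθ i).map hψ j.succ
    have hψθ : ∀ y, ψ (θ (π₂ y)) = ψ (θ y) := by
      intro y
      ext j
      refine Fin.cases ?_ (fun j => ?_) j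
      · rw [hpθ, hpθ]
      · exact congrFun (LinearMap.congr_fun hψπ₂ y) j
    -- Since `ψθπ₂ = ψθ` and `θμ = id - π₁`, the composite with `ψ` is `ψπ₁ + ψ(id - π₁) = ψ`.
    refine ⟨π₁ + θ ∘ₗ π₂ ∘ₗ μ, fun x hx => ?_, LinearMap.ext fun x => ?_⟩
    · have hx0 : ψ x = 0 := hx
      have hπx : π₁ x = 0 := hπ₁ x (congrFun hx0 0)
      have hμx : π₂ (μ x) = 0 := by
        refine hπ₂ ?_
        rw [LinearMap.mem_ker, LinearMap.comp_apply, LinearMap.comp_apply, hμ', hπx, sub_zero,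
          hx0, map_zero]
      simp [hπx, hμx]
    · simp [hψθ, hμ']

variable {M : Type*} [AddCommGroup M] [Module R M] {ℳ : Γ → AddSubgroup M}

/-- Over a graded left semihereditary ring, the homogeneous equational criterion is inherited by
submodules. -/
theorem HomogeneousEquationalCriterion.submodule [Decomposition ℳ] [SetLike.GradedSMul 𝒜 ℳ]
    (h : IsGradedLeftSemihereditary 𝒜) (hM : HomogeneousEquationalCriterion 𝒜 ℳ)
    (N : Submodule R M) :
    HomogeneousEquationalCriterion 𝒜 fun γ => (ℳ γ).comap N.subtype.toAddMonoidHom := by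
  intro n γ φ δ t hφ ht h0
  obtain ⟨m, ε, ψ, χ, hψ, -, hcomp, hk⟩ := hM.factorsThroughGradedFree (φ := N.subtype ∘ₗ φ)
    hφ ht (by rw [LinearMap.comp_apply, h0, map_zero])
  obtain ⟨π, hπ, hψπ⟩ := h.exists_retraction hψ
  -- The free module is `Rⁿ` itself with second factor `φ`, which lands in `N`; `φπ = φ` is checked
  -- after inclusion into `M`.
  refine ⟨n, π, φ, ?_, fun s hs => hπ (hk s hs)⟩
  refine (LinearMap.cancel_left N.injective_subtype).1 ?_
  rw [← LinearMap.comp_assoc, ← hcomp, LinearMap.comp_assoc, hψπ]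

/-- For a homogeneous generator `x`, every component of `r • x` is again a multiple of `x`. -/
theorem IsGradedSubmodule.decompose_mem [Decomposition ℳ] [SetLike.GradedSMul 𝒜 ℳ]
    {N : Submodule R M} (hN : IsGradedSubmodule ℳ N) {x : M} (hx : x ∈ N) (γ : Γ) :
    (decompose ℳ x γ : M) ∈ N := by
  obtain ⟨S, hS, rfl⟩ := hN
  induction hx using Submodule.closure_induction with
  | zero => simp
  | add x y _ _ hx hy =>
    rw [decompose_add, DirectSum.add_apply, AddSubgroup.coe_add]
    exact add_mem hx hy
  | smul_mem r x hx =>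
    obtain ⟨α, hα⟩ := hS x hx
    rw [decompose_smul_of_mem 𝒜 hα]
    exact Submodule.smul_mem _ _ (Submodule.subset_span hx)

variable (𝒜) in
/-- For graded submodules, the homogeneous equational criterion implies the full one. -/
theorem HomogeneousEquationalCriterion.equationalCriterion_submodule [Decomposition ℳ]
    [SetLike.GradedSMul 𝒜 ℳ] {N : Submodule R M} (hN : IsGradedSubmodule ℳ N)
    (h : HomogeneousEquationalCriterion 𝒜 fun γ => (ℳ γ).comap N.subtype.toAddMonoidHom) :
    EquationalCriterion R N := by
  have hint : DirectSum.IsInternal fun γ => (ℳ γ).comap N.subtype.toAddMonoidHom :=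
    isInternal_comap ℳ _ N.injective_subtype fun a γ =>
      ⟨⟨_, hN.decompose_mem (𝒜 := 𝒜) a.2 γ⟩, rfl⟩
  let : Decomposition fun γ => (ℳ γ).comap N.subtype.toAddMonoidHom := hint.chooseDecomposition
  have : SetLike.GradedSMul 𝒜 fun γ => (ℳ γ).comap N.subtype.toAddMonoidHom :=
    ⟨fun {_ _ _ _} ha hb => SetLike.GradedSMul.smul_mem (A := 𝒜) (B := ℳ) ha hb⟩
  exact h.equationalCriterion

theorem IsGradedLeftSemihereditary.equationalCriterion_submodule {M : Type w} [AddCommGroup M]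
    [Module R M] {ℳ : Γ → AddSubgroup M} [Decomposition ℳ] [SetLike.GradedSMul 𝒜 ℳ]
    (h : IsGradedLeftSemihereditary 𝒜) (hM : IsGradedFlat 𝒜 M) {N : Submodule R M}
    (hN : IsGradedSubmodule ℳ N) : EquationalCriterion R N :=
  ((hM.homogeneousEquationalCriterion ℳ).submodule h N).equationalCriterion_submodule 𝒜 hN

/-- A graded left coherent ring is graded left semihereditary as soon as the homogeneous left
ideals, viewed as submodules of a copy of the ring in a larger universe, are gr-flat. -/
theorem IsGradedLeftCoherent.isGradedLeftSemihereditary (h : IsGradedLeftCoherent 𝒜)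
    (hflat : ∀ (ℳ : Γ → AddSubgroup (ULift.{w} R)) [Decomposition ℳ] [SetLike.GradedSMul 𝒜 ℳ]
      (N : Submodule R (ULift.{w} R)), IsGradedSubmodule ℳ N → IsGradedFlat 𝒜 N) :
    IsGradedLeftSemihereditary 𝒜 := by
  intro I hI hI'
  let e : ULift.{w} R ≃ₗ[R] R := ULift.moduleEquiv
  let ℳ : Γ → AddSubgroup (ULift.{w} R) := fun γ => (𝒜 γ).comap e.toLinearMap.toAddMonoidHom
  have hint : DirectSum.IsInternal ℳ :=
    isInternal_comap 𝒜 _ e.injective fun a γ => ⟨ULift.up _, rfl⟩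
  let : Decomposition ℳ := hint.chooseDecomposition
  have : SetLike.GradedSMul 𝒜 ℳ :=
    ⟨fun {_ _ _ _} ha hb => SetLike.mul_mem_graded (A := 𝒜) ha hb⟩
  let N : Submodule R (ULift.{w} R) := Submodule.map e.symm.toLinearMap I
  have hN : IsGradedSubmodule ℳ N := by
    obtain ⟨S, hS, rfl⟩ := hI'
    refine ⟨e.symm '' S, ?_, Submodule.map_span _ _⟩
    rintro _ ⟨x, hx, rfl⟩
    exact hS x hx
  have hEC : EquationalCriterion R N := HomogeneousEquationalCriterion.equationalCriterion_submodule
    𝒜 hN ((hflat ℳ N hN).homogeneousEquationalCriterion _)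
  have := h I hI hI'
  exact (hEC.of_equiv (e.symm.submoduleMap I).symm).projective

end Semihereditary

theorem theorem2p10 {Γ : Type v} [AddCancelMonoid Γ] [DecidableEq Γ]
    {R : Type u} [Ring R] (𝒜 : Γ → AddSubgroup R) [GradedRing 𝒜] :
    (IsGradedLeftSemihereditary 𝒜 ↔
      (IsGradedLeftCoherent 𝒜 ∧
        ∀ (M : Type (max u w)) [AddCommGroup M] [Module R M] (ℳ : Γ → AddSubgroup M)
          [DirectSum.Decomposition ℳ] [SetLike.GradedSMul 𝒜 ℳ],
          IsGradedFlat 𝒜 M →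
            ∀ N : Submodule R M, IsGradedSubmodule ℳ N → IsGradedFlat 𝒜 N)) ∧
    (IsGradedLeftSemihereditary 𝒜 ↔
      (IsGradedLeftCoherent 𝒜 ∧
        ∀ (M : Type (max u w)) [AddCommGroup M] [Module R M] (ℳ : Γ → AddSubgroup M)
          [DirectSum.Decomposition ℳ] [SetLike.GradedSMul 𝒜 ℳ],
          IsFlatLeftModule R M →
            ∀ N : Submodule R M, IsGradedSubmodule ℳ N → IsFlatLeftModule R N)) := by
  -- The ambient module for both converse directions, in the universe of the test modules.
  have hflat : IsFlatLeftModule R (ULift.{w} R) :=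
    (equationalCriterion_self.of_equiv ULift.moduleEquiv.symm).isFlatLeftModule
  refine ⟨⟨fun h => ⟨h.isGradedLeftCoherent, fun M _ _ ℳ _ _ hM N hN => ?_⟩,
    fun ⟨hc, h⟩ => ?_⟩, ⟨fun h => ⟨h.isGradedLeftCoherent, fun M _ _ ℳ _ _ hM N hN => ?_⟩,
    fun ⟨hc, h⟩ => ?_⟩⟩
  · exact (h.equationalCriterion_submodule hM hN).isFlatLeftModule.isGradedFlat
  · exact hc.isGradedLeftSemihereditary fun ℳ _ _ N hN => h _ ℳ hflat.isGradedFlat N hN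
  · exact (h.equationalCriterion_submodule hM.isGradedFlat hN).isFlatLeftModule
  · exact hc.isGradedLeftSemihereditary fun ℳ _ _ N hN => (h _ ℳ hflat N hN).isGradedFlat
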